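/- Let $(R,\mathfrak m)$ be a commutative Noetherian local ring and let $M$ be a finitely generated $R$-module which is locally free on the punctured spectrum of $R$, i.e. $M_{\mathfrak p}$ is a free $R_{\mathfrak p}$-module for every prime ideal $\mathfrak p\neq\mathfrak m$ of $R$. Let $\operatorname{depth}(R)$ denote the supremum of the lengths of the $R$-regular sequences contained in $\mathfrak m$, and let $\operatorname{pd}_R$ denote projective dimension, with the convention $\operatorname{pd}_R(0)=-\infty$. If $\operatorname{pd}_R(M)\le \operatorname{depth}(R)/2$, then $\operatorname{pd}_R(M\otimes_R M)<\infty$. -/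

import Mathlib

universe u v

/-- The depth of a local ring `R`: the supremum of the lengths of the `R`-regular sequences
contained in the maximal ideal of `R`. -/
noncomputable def localRingDepth (R : Type u) [CommRing R] [IsLocalRing R] : ℕ∞ :=
  ⨆ rs : {rs : List R // RingTheory.Sequence.IsRegular R rs ∧
    ∀ r ∈ rs, r ∈ IsLocalRing.maximalIdeal R}, (rs.1.length : ℕ∞)

/-- The module `M` over the local ring `R` is locally free on the punctured spectrum:
`M_p` is a free `R_p`-module for every prime ideal `p` different from the maximal ideal. -/
def IsLocallyFreeOnPuncturedSpectrum (R : Type u) [CommRing R] [IsLocalRing R]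
    (M : Type v) [AddCommGroup M] [Module R M] : Prop :=
  ∀ p : PrimeSpectrum R, p ≠ IsLocalRing.closedPoint R →
    Module.Free (Localization.AtPrime p.asIdeal) (LocalizedModule p.asIdeal.primeCompl M)

/-! Let `pd M = n`, so `depth R ≥ 2n`. Depth is measured by vanishing of `Ext` from the residue
field. For a syzygy sequence `0 → K → F → N → 0`, the kernel of `M ⊗ K → M ⊗ F` is `Tor₁(M, N)`,
supported only at the closed point because `M` is free elsewhere. If `M ⊗ K` has positive depth,
this kernel vanishes and the tensored sequence stays exact. By induction on `pd N`, `M ⊗ N` loses at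
most `pd N` in depth and gains at most `pd N` in projective dimension, provided `pd N ≤ depth M`.
This is `extVanishesBelow_and_hasProjectiveDimensionLT_tensorProduct`. It is used twice: for `R ⊗
M`, giving `depth M ≥ 2n - n = n`, and then for `M ⊗ M`. -/

open CategoryTheory Abelian IsLocalRing TensorProduct

namespace CategoryTheory

variable {C : Type*} [Category* C] [Abelian C]

/-- If the identity of `Y` is a finite sum of endomorphisms factoring through `Z`, the vanishing
of `Ext X Z n` implies that of `Ext X Y n`. -/
lemma subsingleton_ext_of_id_eq_sum [HasExt C] {X Y Z : C} {ι : Type*} [Fintype ι]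
    (p : ι → (Y ⟶ Z)) (q : ι → (Z ⟶ Y)) (h : 𝟙 Y = ∑ i, p i ≫ q i) (n : ℕ)
    [Subsingleton (Ext X Z n)] : Subsingleton (Ext X Y n) := by
  refine subsingleton_of_forall_eq 0 fun e ↦ ?_
  rw [← e.comp_mk₀_id, h, Ext.mk₀_sum, Ext.comp_sum]
  refine Finset.sum_eq_zero fun i _ ↦ ?_
  rw [← Ext.mk₀_comp_mk₀, ← Ext.comp_assoc_of_second_deg_zero,
    Subsingleton.elim (e.comp (Ext.mk₀ (p i)) (add_zero n)) 0, Ext.zero_comp]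

/-- If the identity of `Y` is a finite sum of endomorphisms factoring through `Z`, the projective
dimension of `Y` is bounded by that of `Z`. -/
lemma hasProjectiveDimensionLT_of_id_eq_sum {Y Z : C} {ι : Type*} [Fintype ι]
    (p : ι → (Y ⟶ Z)) (q : ι → (Z ⟶ Y)) (h : 𝟙 Y = ∑ i, p i ≫ q i) (n : ℕ)
    [HasProjectiveDimensionLT Z n] : HasProjectiveDimensionLT Y n := by
  let := HasExt.standard C
  rw [hasProjectiveDimensionLT_iff]
  intro i hi X e
  rw [← e.mk₀_id_comp, h, Ext.mk₀_sum, Ext.sum_comp]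
  refine Finset.sum_eq_zero fun j _ ↦ ?_
  rw [← Ext.mk₀_comp_mk₀, Ext.comp_assoc_of_second_deg_zero,
    ((Ext.mk₀ (q j)).comp e (zero_add i)).eq_zero_of_hasProjectiveDimensionLT n hi,
    Ext.comp_zero]

/-- In a short exact sequence, vanishing of `Ext X` in degree `n` at the middle term and in degree
`n + 1` at the left term implies vanishing in degree `n` at the right term. -/
lemma ShortComplex.ShortExact.subsingleton_ext_X₃ [HasExt C] {S : ShortComplex C}
    (hS : S.ShortExact) (X : C) (n : ℕ) [Subsingleton (Ext X S.X₂ n)]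
    [Subsingleton (Ext X S.X₁ (n + 1))] : Subsingleton (Ext X S.X₃ n) := by
  refine subsingleton_of_forall_eq 0 fun e ↦ ?_
  obtain ⟨x, rfl⟩ := Ext.covariant_sequence_exact₃ X hS e rfl (Subsingleton.elim _ _)
  rw [Subsingleton.elim x 0, Ext.zero_comp]

end CategoryTheory

namespace IsLocalRing

variable {R : Type u} [CommRing R]

/-- The identity of `M ⊗ N`, for `N` finite free, is a finite sum of endomorphisms factoring
through `M`. -/
lemma exists_id_tensorProduct_eq_sum (M N : Type u) [AddCommGroup M] [Module R M]
    [AddCommGroup N] [Module R N] [Module.Finite R N] [Module.Free R N] :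
    ∃ (p : Module.Free.ChooseBasisIndex R N → (ModuleCat.of R (M ⊗[R] N) ⟶ ModuleCat.of R M))
      (q : Module.Free.ChooseBasisIndex R N → (ModuleCat.of R M ⟶ ModuleCat.of R (M ⊗[R] N))),
      𝟙 (ModuleCat.of R (M ⊗[R] N)) = ∑ i, p i ≫ q i := by
  let b := Module.Free.chooseBasis R N
  refine ⟨fun i ↦ ModuleCat.ofHom ((TensorProduct.rid R M).toLinearMap ∘ₗ (b.coord i).lTensor M),
    fun i ↦ ModuleCat.ofHom ((TensorProduct.mk R M N).flip (b i)), ?_⟩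
  ext : 1
  rw [ModuleCat.hom_sum]
  refine TensorProduct.ext' fun m n ↦ ?_
  simp only [ModuleCat.hom_id, LinearMap.id_apply, LinearMap.sum_apply, ModuleCat.hom_comp,
    ModuleCat.hom_ofHom, LinearMap.comp_apply, LinearMap.lTensor_tmul, LinearEquiv.coe_coe,
    TensorProduct.rid_tmul, LinearMap.flip_apply, TensorProduct.mk_apply, Module.Basis.coord_apply,
    TensorProduct.smul_tmul]
  rw [← TensorProduct.tmul_sum, b.sum_repr]

variable [IsLocalRing R]

/-- The vanishing of `Ext i` from the residue field to `M` for all `i < n`; for finitely generated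
`M ≠ 0` over a Noetherian local ring this says that `M` has depth at least `n`. -/
def ExtVanishesBelow (n : ℕ) (M : Type u) [AddCommGroup M] [Module R M] : Prop :=
  ∀ i < n, Subsingleton (Ext (ModuleCat.of R (R ⧸ maximalIdeal R)) (ModuleCat.of R M) i)

variable {M N K F : Type u} [AddCommGroup M] [Module R M] [AddCommGroup N] [Module R N]
  [AddCommGroup K] [Module R K] [AddCommGroup F] [Module R F]

lemma ExtVanishesBelow.tensorProduct_free {n : ℕ} (h : ExtVanishesBelow (R := R) n M)
    [Module.Finite R N] [Module.Free R N] : ExtVanishesBelow (R := R) n (M ⊗[R] N) := by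
  intro i hi
  have := h i hi
  obtain ⟨p, q, hpq⟩ := exists_id_tensorProduct_eq_sum (R := R) M N
  exact subsingleton_ext_of_id_eq_sum p q hpq i

lemma ExtVanishesBelow.of_linearEquiv {n : ℕ} (h : ExtVanishesBelow (R := R) n M)
    (e : N ≃ₗ[R] M) : ExtVanishesBelow (R := R) n N := by
  intro i hi
  have := h i hi
  exact subsingleton_ext_of_id_eq_sum (ι := Unit) (fun _ ↦ e.toModuleIso.hom)
    (fun _ ↦ e.toModuleIso.inv) (by rw [Fintype.sum_unique, Iso.hom_inv_id]) i

lemma ExtVanishesBelow.mono {m n : ℕ} (h : ExtVanishesBelow (R := R) n M) (hmn : m ≤ n) :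
    ExtVanishesBelow (R := R) m M :=
  fun i hi ↦ h i (hi.trans_le hmn)

/-- If `M` is locally free on the punctured spectrum and `M ⊗ K` has no nonzero element killed by
the maximal ideal, then tensoring an injection `K → F` with `M` preserves injectivity. -/
lemma lTensor_injective_of_extVanishesBelow [IsNoetherianRing R]
    (hM : IsLocallyFreeOnPuncturedSpectrum R M) (hK : ExtVanishesBelow (R := R) 1 (M ⊗[R] K))
    (f : K →ₗ[R] F) (hf : Function.Injective f) : Function.Injective (f.lTensor M) := by
  rw [← LinearMap.ker_eq_bot, ← Submodule.subsingleton_iff_eq_bot]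
  by_contra hnt
  rw [not_subsingleton_iff_nontrivial] at hnt
  -- A nonzero kernel contains a copy of `R ⧸ P`. Positive depth of `M ⊗ K` excludes `P = 𝔪`;
  -- flatness of `M_P` excludes every other `P`.
  obtain ⟨P, hP⟩ := associatedPrimes.nonempty R (LinearMap.ker (f.lTensor M))
  have hprime : P.IsPrime := hP.isPrime
  obtain ⟨-, g, hg⟩ :=
    (isAssociatedPrime_iff_exists_injective_linearMap P (LinearMap.ker (f.lTensor M))).mp hP
  by_cases hPm : P = maximalIdeal R
  · subst hPm
    have := hK 0 one_pos
    have : Subsingleton (ModuleCat.of R (R ⧸ maximalIdeal R) ⟶ ModuleCat.of R (M ⊗[R] K)) :=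
      Ext.addEquiv₀.subsingleton_congr.mp this
    have : Subsingleton ((R ⧸ maximalIdeal R) →ₗ[R] (M ⊗[R] K)) :=
      (ModuleCat.homAddEquiv (M := ModuleCat.of R (R ⧸ maximalIdeal R))
        (N := ModuleCat.of R (M ⊗[R] K))).symm.subsingleton
    have h0 := LinearMap.congr_fun
      (Subsingleton.elim ((LinearMap.ker (f.lTensor M)).subtype ∘ₗ g) 0) 1
    exact one_ne_zero (hg ((Subtype.ext h0).trans (map_zero g).symm))
  · have hfree := hM ⟨P, hprime⟩ fun h ↦ hPm (congrArg PrimeSpectrum.asIdeal h)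
    change Module.Free (Localization.AtPrime P) (LocalizedModule P.primeCompl M) at hfree
    have : Module.Flat R (LocalizedModule P.primeCompl M) :=
      Module.Flat.trans R (Localization.AtPrime P) _
    let ι := LocalizedModule.mkLinearMap P.primeCompl M
    have hloc : IsLocalizedModule P.primeCompl (ι.rTensor K) :=
      IsLocalizedModule.rTensor (A := R) (R := R) P.primeCompl ι
    -- Tensoring `f` with the flat module `M_P` is injective, so the kernel element `g 1` dies in
    -- `M_P ⊗ K`. Some `s ∉ P` then kills it, although its annihilator is `P`.
    have hx : ι.rTensor K (g 1) = 0 := by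
      refine Module.Flat.lTensor_preserves_injective_linearMap (M := LocalizedModule _ M) f hf ?_
      rw [map_zero, ← LinearMap.comp_apply, LinearMap.lTensor_comp_rTensor,
        ← LinearMap.rTensor_comp_lTensor, LinearMap.comp_apply, (g 1).2, map_zero]
    obtain ⟨s, hs⟩ := (IsLocalizedModule.eq_zero_iff P.primeCompl (ι.rTensor K)).mp hx
    refine s.2 (Ideal.Quotient.eq_zero_iff_mem.mp (hg ?_))
    have hs1 : Ideal.Quotient.mk P (s : R) = (s : R) • (1 : R ⧸ P) := by
      rw [Algebra.smul_def, mul_one]; rfl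
    rw [hs1, map_smul, map_zero]
    exact Subtype.ext hs

/-- If `Ext i` from the residue field to `M` vanishes for `i < e`, `M` is locally free on the
punctured spectrum and `N` has projective dimension at most `k ≤ e`, then `Ext i` from the residue
field to `M ⊗ N` vanishes for `i < e - k`, and `pd (M ⊗ N) ≤ pd M + k`. -/
theorem extVanishesBelow_and_hasProjectiveDimensionLT_tensorProduct [IsNoetherianRing R]
    (hM : IsLocallyFreeOnPuncturedSpectrum R M) {e : ℕ} (he : ExtVanishesBelow (R := R) e M)
    (k : ℕ) (hk : k ≤ e) (N : Type u) [AddCommGroup N] [Module R N] [Module.Finite R N]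
    (hN : HasProjectiveDimensionLE (ModuleCat.of R N) k) :
    ExtVanishesBelow (R := R) (e - k) (M ⊗[R] N) ∧
      ∀ n, HasProjectiveDimensionLE (ModuleCat.of R M) n →
        HasProjectiveDimensionLE (ModuleCat.of R (M ⊗[R] N)) (n + k) := by
  induction k generalizing N with
  | zero =>
    have hproj : Module.Projective R N := IsProjective.iff_projective _ |>.mpr
      ((projective_iff_hasProjectiveDimensionLE_zero _).mpr hN)
    have : Module.Free R N := Module.free_of_flat_of_isLocalRing
    refine ⟨he.tensorProduct_free, fun n hn ↦ ?_⟩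
    obtain ⟨p, q, hpq⟩ := exists_id_tensorProduct_eq_sum (R := R) M N
    exact hasProjectiveDimensionLT_of_id_eq_sum p q hpq _
  | succ k ih =>
    obtain ⟨m, π, hπ⟩ := Module.Finite.exists_fin' R N
    let S : ShortComplex (ModuleCat.{u} R) := ShortComplex.mk
      (ModuleCat.ofHom (LinearMap.ker π).subtype) (ModuleCat.ofHom π) (by ext x; exact x.2)
    have hS : S.ShortExact := LinearMap.shortExact_shortComplexKer hπ
    have hK : HasProjectiveDimensionLE (ModuleCat.of R (LinearMap.ker π)) k :=
      hS.hasProjectiveDimensionLT_X₁ (k + 1) inferInstance hN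
    obtain ⟨hd, hp⟩ := ih (by omega) (LinearMap.ker π) hK
    -- The induction hypothesis gives vanishing below `e - k`, and `k + 1 ≤ e` makes this at least
    -- `1`.
    have hinj := lTensor_injective_of_extVanishesBelow hM (hd.mono (by omega))
      (LinearMap.ker π).subtype (Submodule.subtype_injective _)
    let T : ShortComplex (ModuleCat.{u} R) := ShortComplex.mk
      (ModuleCat.ofHom ((LinearMap.ker π).subtype.lTensor M)) (ModuleCat.ofHom (π.lTensor M))
      (by rw [← ModuleCat.ofHom_comp, ← LinearMap.lTensor_comp, LinearMap.comp_ker_subtype,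
        LinearMap.lTensor_zero]; rfl)
    have hexact : T.Exact := (ShortComplex.ShortExact.moduleCat_exact_iff_function_exact T).mpr
      (lTensor_exact M (LinearMap.exact_subtype_ker_map π) hπ)
    have hT : T.ShortExact :=
      { exact := hexact
        mono_f := (ModuleCat.mono_iff_injective _).mpr hinj
        epi_g := (ModuleCat.epi_iff_surjective _).mpr (LinearMap.lTensor_surjective M hπ) }
    refine ⟨fun i hi ↦ ?_, fun n hn ↦ ?_⟩
    · have := hd (i + 1) (by omega)
      have := he.tensorProduct_free (N := Fin m → R) i (by omega)
      exact hT.subsingleton_ext_X₃ _ i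
    · refine hT.hasProjectiveDimensionLT_X₃ (n + k + 1) (hp n hn) ?_
      obtain ⟨p, q, hpq⟩ := exists_id_tensorProduct_eq_sum (R := R) M (Fin m → R)
      have : HasProjectiveDimensionLT (ModuleCat.of R M) (n + k + 1 + 1) :=
        hasProjectiveDimensionLT_of_ge _ (n + 1) _ (by omega)
      exact hasProjectiveDimensionLT_of_id_eq_sum p q hpq _

lemma isLocallyFreeOnPuncturedSpectrum_self : IsLocallyFreeOnPuncturedSpectrum R R := fun p _ ↦
  Module.Free.of_equiv (LinearEquiv.refl _ (Localization.AtPrime p.asIdeal))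

/-- Each term of a regular sequence lowers the Krull dimension by one, and a Noetherian local ring
has finite dimension. This excludes `pd M = ⊤` in the main theorem. -/
lemma localRingDepth_ne_top [IsNoetherianRing R] : localRingDepth R ≠ ⊤ := by
  suffices h : (localRingDepth R : WithBot ℕ∞) ≤ ringKrullDim R from fun htop ↦
    (h.trans_lt ringKrullDim_lt_top).ne (by rw [htop]; rfl)
  obtain ⟨d, hd⟩ := WithBot.ne_bot_iff_exists.mp (ringKrullDim_ne_bot (R := R))
  rw [← hd, WithBot.coe_le_coe]
  refine iSup_le fun ⟨rs, hreg, _⟩ ↦ ?_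
  have hle := ringKrullDim_add_length_eq_ringKrullDim_of_isRegular rs hreg
  have : Nontrivial (R ⧸ Ideal.ofList rs) := by
    refine Ideal.Quotient.nontrivial_iff.mpr fun htop ↦ hreg.top_ne_smul ?_
    rw [htop, Submodule.top_smul]
  rw [← WithBot.coe_le_coe, hd, ← hle]
  exact le_add_of_nonneg_left ringKrullDim_nonneg_of_nontrivial

lemma extVanishesBelow_of_le_localRingDepth [IsNoetherianRing R] {n : ℕ}
    (h : (n : ℕ∞) ≤ localRingDepth R) : ExtVanishesBelow (R := R) n R := by
  intro i hi
  -- For each `i < n`, a sequence longer than `i` suffices; the supremum need not be known to be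
  -- attained.
  obtain ⟨⟨rs, hreg, hmem⟩, hlt⟩ := lt_iSup_iff.mp (lt_of_lt_of_le (Nat.cast_lt.mpr hi) h)
  refine ModuleCat.subsingleton_ext_of_exists_isRegular (maximalIdeal R) _ ?_ _ ?_ rs hmem hreg i
    (Nat.cast_lt.mp hlt)
  · simp [Module.support_eq_zeroLocus, Ideal.annihilator_quotient]
  · simpa using (maximalIdeal.isMaximal R).ne_top.lt_top

end IsLocalRing

theorem mainTheorem9 (R : Type u) [CommRing R] [IsLocalRing R] [IsNoetherianRing R]
    (M : Type u) [AddCommGroup M] [Module R M] [Module.Finite R M]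
    (hfree : IsLocallyFreeOnPuncturedSpectrum R M)
    (hpd : 2 * CategoryTheory.projectiveDimension (ModuleCat.of R M) ≤
      ((localRingDepth R : ℕ∞) : WithBot ℕ∞)) :
    CategoryTheory.projectiveDimension (ModuleCat.of R (TensorProduct R M M)) < ⊤ := by
  generalize hd : projectiveDimension (ModuleCat.of R M) = d at hpd
  induction d with
  | bot =>
    have : Subsingleton M := ModuleCat.isZero_iff_subsingleton.mp
      ((projectiveDimension_eq_bot_iff _).mp hd)
    have hzero : projectiveDimension (ModuleCat.of R (M ⊗[R] M)) = ⊥ :=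
      (projectiveDimension_eq_bot_iff _).mpr
        (ModuleCat.isZero_of_iff_subsingleton.mpr inferInstance)
    rw [hzero]
    exact bot_lt_top
  | coe d =>
  induction d with
  | top =>
    refine absurd (top_le_iff.mp ?_) (IsLocalRing.localRingDepth_ne_top (R := R))
    rw [← WithBot.coe_le_coe]
    exact hpd
  | coe n =>
    have hn : projectiveDimension (ModuleCat.of R M) = n := hd
    have hM : HasProjectiveDimensionLE (ModuleCat.of R M) n :=
      (projectiveDimension_le_iff _ n).mp hn.le
    have hdepth : ((2 * n : ℕ) : ℕ∞) ≤ localRingDepth R := by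
      rw [← WithBot.coe_le_coe]
      refine le_of_eq_of_le ?_ hpd
      push_cast
      rfl
    have hR := IsLocalRing.extVanishesBelow_of_le_localRingDepth hdepth
    -- The inequality half of Auslander–Buchsbaum: the tensor theorem for `R ⊗ M` with `e = 2n` and
    -- `k = n`.
    have hMdepth : IsLocalRing.ExtVanishesBelow (R := R) n M :=
      ((IsLocalRing.extVanishesBelow_and_hasProjectiveDimensionLT_tensorProduct
        IsLocalRing.isLocallyFreeOnPuncturedSpectrum_self hR n (by omega) M hM).1.mono
          (by omega)).of_linearEquiv (TensorProduct.lid R M).symm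
    -- Here `e = k = n`, the extreme case allowed; it yields `pd (M ⊗ M) ≤ 2n`.
    have := (IsLocalRing.extVanishesBelow_and_hasProjectiveDimensionLT_tensorProduct
      hfree hMdepth n le_rfl M hM).2 n hM
    exact ((projectiveDimension_ne_top_iff _).mpr ⟨_, this⟩).lt_top
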